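/- A rotation system $R=\langle G,T\rangle$ on a finite simple graph $G$ is the relational structure on the vertex set $V(G)$ with the binary adjacency relation of $G$ and a ternary relation $T$ such that (1) $T(x,y,z)$ implies that $y$ and $z$ are neighbors of $x$ in $G$, and (2) for every vertex $x$ the binary relation $T_x=\{(y,z): T(x,y,z)\}$ is a (single) directed cycle on the set of neighbors of $x$ (a loop if $x$ has exactly one neighbor, empty if it has none). Let $D^5(R)$ be the minimum quantifier depth (maximum number of nested quantifiers) of a first-order sentence $\Phi$ without counting quantifiers, in the language with equality, one binary and one ternary relation symbol, that uses at most five variables (each of which may be quantified repeatedly) and defines $R$, i.e., $\Phi$ is true on $R$ and false on every nonempty structure of the same signature, finite or infinite, that is not isomorphic to $R$; $D^5(R)=\infty$ if there is no such sentence. Theorem. Let $R=\langle G,T\rangle$ be a rotation system for a connected graph $G$ with $n$ vertices. Then $$D^5(R)<3\log_2 n+8 .$$ -/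

import Mathlib

universe u w

/-- First-order formulas (without counting quantifiers) over the language `L` in which only the
`k` variables `x_0, …, x_{k-1}` may be used. A variable may be quantified again and again, also
inside the scope of another quantifier over the same variable. The remaining connectives and the
existential quantifier are the usual classical abbreviations. -/
inductive KVarFormula (L : FirstOrder.Language.{0, 0}) (k : ℕ) : Type
  /-- falsity -/
  | falsum : KVarFormula L k
  /-- equality of two terms -/
  | equal (s t : L.Term (Fin k)) : KVarFormula L k
  /-- a relation symbol applied to terms -/
  | rel {m : ℕ} (R : L.Relations m) (ts : Fin m → L.Term (Fin k)) : KVarFormula L k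
  /-- implication -/
  | imp (φ ψ : KVarFormula L k) : KVarFormula L k
  /-- universal quantification over the variable `x_i` -/
  | all (i : Fin k) (φ : KVarFormula L k) : KVarFormula L k

namespace KVarFormula

variable {L : FirstOrder.Language.{0, 0}} {k : ℕ}

/-- The quantifier depth: the maximum number of nested quantifiers. -/
def quantifierDepth : KVarFormula L k → ℕ
  | falsum => 0
  | equal _ _ => 0
  | rel _ _ => 0
  | imp φ ψ => max φ.quantifierDepth ψ.quantifierDepth
  | all _ φ => φ.quantifierDepth + 1

/-- The set of variables that occur freely. -/
def freeVars : KVarFormula L k → Finset (Fin k)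
  | falsum => ∅
  | equal s t => s.varFinset ∪ t.varFinset
  | rel _ ts => Finset.univ.biUnion fun j => (ts j).varFinset
  | imp φ ψ => φ.freeVars ∪ ψ.freeVars
  | all i φ => φ.freeVars.erase i

/-- A sentence is a formula without free variables. -/
def IsSentence (φ : KVarFormula L k) : Prop := φ.freeVars = ∅

/-- Truth of a formula in a structure under an assignment of elements to the `k` variables. -/
def Realize {M : Type u} [L.Structure M] : KVarFormula L k → (Fin k → M) → Prop
  | falsum, _ => False
  | equal s t, v => s.realize v = t.realize v
  | rel R ts, v => FirstOrder.Language.Structure.RelMap R fun j => (ts j).realize v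
  | imp φ ψ, v => φ.Realize v → ψ.Realize v
  | all i φ, v => ∀ a : M, φ.Realize (Function.update v i a)

/-- Truth of a sentence in a (nonempty) structure; for a sentence the assignment is irrelevant. -/
def IsTrueIn (φ : KVarFormula L k) (M : Type u) [L.Structure M] : Prop :=
  ∀ v : Fin k → M, φ.Realize v

/-- The formula `φ` defines the structure `M`: it is a sentence, it is true in `M`, and it is false
in every structure of the same signature that is not isomorphic to `M`. As usual in first-order
logic, structures have a nonempty universe. They need not be finite, and the relations need not
satisfy any condition. -/
def Defines (φ : KVarFormula L k) (M : Type u) [L.Structure M] : Prop :=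
  φ.IsSentence ∧ φ.IsTrueIn M ∧
    ∀ (N : Type w) [Nonempty N] [L.Structure N], IsEmpty (L.Equiv M N) → ¬ φ.IsTrueIn N

end KVarFormula

/-- The relation symbols of the language of rotation systems: a binary symbol for adjacency and
a ternary symbol for the rotation. -/
inductive RotationRel : ℕ → Type
  | adj : RotationRel 2
  | rot : RotationRel 3

/-- The language of rotation systems; it has no function symbols and no constants. -/
def rotationLanguage : FirstOrder.Language.{0, 0} := ⟨fun _ => Empty, RotationRel⟩

/-- A rotation system on the (finite) graph `G`: a ternary relation `T` on the vertices such that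
for every vertex `x` the binary relation `T x` is a directed cycle on the neighborhood of `x`. On a
single neighbor `y` the directed cycle is the loop `T x y y`. -/
structure RotationSystem {V : Type u} (G : SimpleGraph V) where
  /-- `T x y z` says that `z` comes next after `y` in the circular order around `x`. -/
  T : V → V → V → Prop
  adj_of_T : ∀ x y z, T x y z → G.Adj x y ∧ G.Adj x z
  existsUnique_next : ∀ x y, G.Adj x y → ∃! z, T x y z
  existsUnique_prev : ∀ x z, G.Adj x z → ∃! y, T x y z
  /-- There is just one cycle: every neighbor of `x` is reached from every other one. -/
  reachable : ∀ x y z, G.Adj x y → G.Adj x z → Relation.ReflTransGen (T x) y z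

/-- The relational structure `⟨G, T⟩` on the vertex set. -/
@[reducible]
def RotationSystem.toStructure {V : Type u} {G : SimpleGraph V} (R : RotationSystem G) :
    rotationLanguage.Structure V where
  funMap := fun f => Empty.elim f
  RelMap
    | RotationRel.adj => fun x => G.Adj (x 0) (x 1)
    | RotationRel.rot => fun x => R.T (x 0) (x 1) (x 2)

/-! Once an edge `ab` is fixed, the rotation names every vertex. A vertex `u` is the end of a walk
that starts with `ab`, and such a walk is determined by its list of turns, each turn counting places
in the cyclic order at the current vertex. With `n` vertices, fewer than `n` turns suffice, each
smaller than `n` (`exists_isWalk`).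

Both counts are handled by halving. A turn `d ≤ 2 ^ m` costs depth `m`, one midpoint per halving
(`ternaryDefinable_relPow`). A walk of at most `2 ^ k` turns is cut at an edge, two vertices per
halving, which costs `2 * k + m` in all (`ternaryDefinable_isWalk`). With `k = m = clog n`, every
vertex gets a formula of depth `3 * clog n` with parameters `a`, `b`.

The defining sentence quantifies `a` and `b`, and then three elements to state that these formulas
name all elements and that the atomic relations among the named elements are those of `R`. This
gives depth `3 * clog n + 5`, and `clog n < log₂ n + 1`. -/

namespace KVarFormula

/-! ### Derived connectives and the bookkeeping of depth and free variables. -/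

section Connectives

variable {L : FirstOrder.Language.{0, 0}} {k : ℕ}

/-- Negation. -/
def neg (φ : KVarFormula L k) : KVarFormula L k := imp φ falsum

/-- Conjunction. -/
def conj (φ ψ : KVarFormula L k) : KVarFormula L k := neg (imp φ (neg ψ))

/-- Existential quantification over the variable `x_i`. -/
def ex (i : Fin k) (φ : KVarFormula L k) : KVarFormula L k := neg (all i (neg φ))

/-- The formula `φ` if `p` holds, and its negation otherwise. -/
noncomputable def literal (p : Prop) (φ : KVarFormula L k) : KVarFormula L k :=
  open Classical in if p then φ else neg φ

/-- Conjunction over a list of indices. -/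
def listConj {ι : Type*} (l : List ι) (f : ι → KVarFormula L k) : KVarFormula L k :=
  l.foldr (fun a φ => conj (f a) φ) (neg falsum)

/-- Conjunction over a finite type of indices. -/
noncomputable def bigConj {ι : Type*} [Fintype ι] (f : ι → KVarFormula L k) : KVarFormula L k :=
  listConj Finset.univ.toList f

/-- Disjunction over a finite type of indices. -/
noncomputable def bigDisj {ι : Type*} [Fintype ι] (f : ι → KVarFormula L k) : KVarFormula L k :=
  neg (bigConj fun a => neg (f a))

variable {M : Type w} [L.Structure M] {φ ψ : KVarFormula L k} {v : Fin k → M}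

@[simp] lemma realize_neg : (neg φ).Realize v ↔ ¬ φ.Realize v := Iff.rfl

@[simp] lemma realize_imp : (imp φ ψ).Realize v ↔ (φ.Realize v → ψ.Realize v) := Iff.rfl

@[simp] lemma realize_conj : (conj φ ψ).Realize v ↔ φ.Realize v ∧ ψ.Realize v := by
  simp [conj]

@[simp] lemma realize_all {i : Fin k} :
    (all i φ).Realize v ↔ ∀ a, φ.Realize (Function.update v i a) := Iff.rfl

@[simp] lemma realize_ex {i : Fin k} :
    (ex i φ).Realize v ↔ ∃ a, φ.Realize (Function.update v i a) := by
  simp [ex]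

@[simp] lemma realize_literal {p : Prop} : (literal p φ).Realize v ↔ (φ.Realize v ↔ p) := by
  by_cases hp : p <;> simp [literal, hp]

lemma realize_listConj {ι : Type*} {l : List ι} {f : ι → KVarFormula L k} :
    (listConj l f).Realize v ↔ ∀ a ∈ l, (f a).Realize v := by
  induction l with
  | nil => simp [listConj, Realize]
  | cons a l ih =>
    change (conj (f a) (listConj l f)).Realize v ↔ _
    simp [ih]

@[simp] lemma realize_bigConj {ι : Type*} [Fintype ι] {f : ι → KVarFormula L k} :
    (bigConj f).Realize v ↔ ∀ a, (f a).Realize v := by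
  simp [bigConj, realize_listConj]

@[simp] lemma realize_bigDisj {ι : Type*} [Fintype ι] {f : ι → KVarFormula L k} :
    (bigDisj f).Realize v ↔ ∃ a, (f a).Realize v := by
  simp [bigDisj]

/-- `φ` has quantifier depth at most `d` and its free variables lie in `s`. -/
def Bounded (d : ℕ) (s : Finset (Fin k)) (φ : KVarFormula L k) : Prop :=
  φ.quantifierDepth ≤ d ∧ φ.freeVars ⊆ s

variable {d : ℕ} {s : Finset (Fin k)}

lemma Bounded.mono {d' : ℕ} {s' : Finset (Fin k)} (h : φ.Bounded d s) (hd : d ≤ d')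
    (hs : s ⊆ s') : φ.Bounded d' s' :=
  ⟨h.1.trans hd, h.2.trans hs⟩

lemma bounded_falsum : (falsum : KVarFormula L k).Bounded d s := by
  simp [Bounded, quantifierDepth, freeVars]

lemma Bounded.imp (h₁ : φ.Bounded d s) (h₂ : ψ.Bounded d s) : (imp φ ψ).Bounded d s :=
  ⟨max_le h₁.1 h₂.1, Finset.union_subset h₁.2 h₂.2⟩

lemma Bounded.neg (h : φ.Bounded d s) : (neg φ).Bounded d s := h.imp bounded_falsum

lemma Bounded.conj (h₁ : φ.Bounded d s) (h₂ : ψ.Bounded d s) : (conj φ ψ).Bounded d s :=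
  (h₁.imp h₂.neg).neg

lemma Bounded.all {i : Fin k} (h : φ.Bounded d (insert i s)) : (all i φ).Bounded (d + 1) s :=
  ⟨Nat.succ_le_succ h.1, Finset.subset_insert_iff.1 h.2⟩

lemma Bounded.ex {i : Fin k} (h : φ.Bounded d (insert i s)) : (ex i φ).Bounded (d + 1) s :=
  h.neg.all.neg

lemma Bounded.literal {p : Prop} (h : φ.Bounded d s) : (literal p φ).Bounded d s := by
  unfold KVarFormula.literal
  split
  exacts [h, h.neg]

lemma bounded_listConj {ι : Type*} {l : List ι} {f : ι → KVarFormula L k}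
    (h : ∀ a, (f a).Bounded d s) : (listConj l f).Bounded d s := by
  induction l with
  | nil => exact bounded_falsum.neg
  | cons a l ih => exact (h a).conj ih

lemma bounded_bigConj {ι : Type*} [Fintype ι] {f : ι → KVarFormula L k}
    (h : ∀ a, (f a).Bounded d s) : (bigConj f).Bounded d s :=
  bounded_listConj h

lemma bounded_bigDisj {ι : Type*} [Fintype ι] {f : ι → KVarFormula L k}
    (h : ∀ a, (f a).Bounded d s) : (bigDisj f).Bounded d s :=
  (bounded_bigConj fun a => (h a).neg).neg

lemma bounded_equal_var {i j : Fin k} (hi : i ∈ s) (hj : j ∈ s) :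
    (equal (.var i) (.var j) : KVarFormula L k).Bounded d s := by
  simp [Bounded, quantifierDepth, freeVars, Finset.insert_subset_iff, hi, hj]

lemma bounded_rel_var {m : ℕ} {r : L.Relations m} {f : Fin m → Fin k} (hf : ∀ j, f j ∈ s) :
    (rel r (fun j => .var (f j))).Bounded d s := by
  refine ⟨Nat.zero_le _, fun x hx => ?_⟩
  simp only [freeVars, Finset.mem_biUnion, FirstOrder.Language.Term.varFinset,
    Finset.mem_singleton] at hx
  obtain ⟨j, -, rfl⟩ := hx
  exact hf j

/-- The truth value depends on the values of the free variables only. -/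
lemma realize_congr {v v' : Fin k → M} (h : ∀ i ∈ φ.freeVars, v i = v' i) :
    φ.Realize v ↔ φ.Realize v' := by
  have term (t : L.Term (Fin k)) {v v' : Fin k → M} (h : ∀ i ∈ t.varFinset, v i = v' i) :
      t.realize v = t.realize v' := by
    induction t with
    | var i => exact h i (by simp [FirstOrder.Language.Term.varFinset])
    | func g ts ih =>
      simp only [FirstOrder.Language.Term.realize]
      congr 1
      funext j
      refine ih j fun i hi => h i ?_
      simp only [FirstOrder.Language.Term.varFinset, Finset.mem_biUnion]
      exact ⟨j, Finset.mem_univ _, hi⟩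
  induction φ generalizing v v' with
  | falsum => rfl
  | equal t u =>
    simp only [freeVars, Finset.mem_union] at h
    simp only [Realize, term t fun i hi => h i (.inl hi), term u fun i hi => h i (.inr hi)]
  | rel r ts =>
    simp only [freeVars, Finset.mem_biUnion] at h
    simp only [Realize]
    rw [funext fun j => term (ts j) fun i hi => h i ⟨j, Finset.mem_univ _, hi⟩]
  | imp φ ψ ih₁ ih₂ =>
    simp only [freeVars, Finset.mem_union] at h
    simp only [Realize, ih₁ fun i hi => h i (.inl hi), ih₂ fun i hi => h i (.inr hi)]
  | all i φ ih =>
    refine forall_congr' fun a => ih fun j hj => ?_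
    by_cases hji : j = i
    · simp [hji]
    · simpa [Function.update_of_ne hji] using h j (by simp [freeVars, hji, hj])

end Connectives

/-! ### Ternary relations definable with five variables. -/

section TernaryDefinable

variable {L : FirstOrder.Language.{0, 0}} {M : Type u} [L.Structure M]

variable (L) in
/-- The ternary relation `Q` is definable with quantifier depth `d` using five variables, whichever
three distinct variables are chosen for its arguments. -/
def TernaryDefinable (d : ℕ) (Q : M → M → M → Prop) : Prop :=
  ∀ i j l : Fin 5, i ≠ j → i ≠ l → j ≠ l → ∃ φ : KVarFormula L 5, φ.Bounded d {i, j, l} ∧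
    ∀ v : Fin 5 → M, φ.Realize v ↔ Q (v i) (v j) (v l)

lemma TernaryDefinable.mono {d d' : ℕ} {Q : M → M → M → Prop} (h : TernaryDefinable L d Q)
    (hd : d ≤ d') : TernaryDefinable L d' Q := by
  intro i j l hij hil hjl
  obtain ⟨φ, hb, hφ⟩ := h i j l hij hil hjl
  exact ⟨φ, hb.mono hd subset_rfl, hφ⟩

lemma TernaryDefinable.swap {d : ℕ} {Q : M → M → M → Prop} (h : TernaryDefinable L d Q) :
    TernaryDefinable L d fun a b c => Q b a c := by
  intro i j l hij hil hjl
  obtain ⟨φ, hb, hφ⟩ := h j i l hij.symm hjl hil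
  exact ⟨φ, hb.mono le_rfl (by rw [Finset.insert_comm]), hφ⟩

lemma ternaryDefinable_eq_right {d : ℕ} : TernaryDefinable L d fun _ b c : M => c = b := by
  intro i j l _ _ _
  exact ⟨equal (.var l) (.var j), bounded_equal_var (by simp) (by simp), fun v => Iff.rfl⟩

lemma TernaryDefinable.comp {d : ℕ} {Q Q' : M → M → M → Prop} (h : TernaryDefinable L d Q)
    (h' : TernaryDefinable L d Q') :
    TernaryDefinable L (d + 1) fun a b c => ∃ m, Q a b m ∧ Q' a m c := by
  intro i j l hij hil hjl
  obtain ⟨p, hpi, hpj, hpl⟩ : ∃ p : Fin 5, p ≠ i ∧ p ≠ j ∧ p ≠ l := by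
    clear hij hil hjl; decide +revert
  obtain ⟨φ, hb, hφ⟩ := h i j p hij hpi.symm hpj.symm
  obtain ⟨ψ, hb', hψ⟩ := h' i p l hpi.symm hil hpl
  refine ⟨ex p (conj φ ψ), ((hb.mono le_rfl ?_).conj (hb'.mono le_rfl ?_)).ex, fun v => ?_⟩
  · intro x; simp; tauto
  · intro x; simp; tauto
  · simp [hφ, hψ, Function.update_of_ne, hpi.symm, hpj.symm, hpl.symm]

/-- This is where five variables are needed: three arguments and the pair `e`, `f`. Each conjunct
has only three free variables, so inside it the other two are free for reuse, and the construction
can be iterated without new variables. -/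
lemma TernaryDefinable.comp_pair {d : ℕ} {Q₁ Q₂ Q₃ : M → M → M → Prop}
    (h₁ : TernaryDefinable L d Q₁) (h₂ : TernaryDefinable L d Q₂)
    (h₃ : TernaryDefinable L d Q₃) :
    TernaryDefinable L (d + 2) fun a b c => ∃ e f, Q₁ a b e ∧ Q₂ a b f ∧ Q₃ e f c := by
  intro i j l hij hil hjl
  obtain ⟨p, q, hpi, hpj, hpl, hqi, hqj, hql, hpq⟩ : ∃ p q : Fin 5,
      p ≠ i ∧ p ≠ j ∧ p ≠ l ∧ q ≠ i ∧ q ≠ j ∧ q ≠ l ∧ p ≠ q := by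
    clear hij hil hjl; decide +revert
  obtain ⟨φ₁, hb₁, hφ₁⟩ := h₁ i j p hij hpi.symm hpj.symm
  obtain ⟨φ₂, hb₂, hφ₂⟩ := h₂ i j q hij hqi.symm hqj.symm
  obtain ⟨φ₃, hb₃, hφ₃⟩ := h₃ p q l hpq hpl hql
  refine ⟨ex p (ex q (conj φ₁ (conj φ₂ φ₃))), ((hb₁.mono le_rfl ?_).conj
    ((hb₂.mono le_rfl ?_).conj (hb₃.mono le_rfl ?_))).ex.ex, fun v => ?_⟩
  · intro x; simp; tauto
  · intro x; simp; tauto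
  · intro x; simp; tauto
  · simp [hφ₁, hφ₂, hφ₃, Function.update_of_ne, hpi.symm, hpj.symm, hpl.symm, hqi.symm, hqj.symm,
      hql.symm, hpq]

end TernaryDefinable

end KVarFormula

/-! ### Iterates of a binary relation. -/

/-- `RelPow r d y z` says that `z` is reached from `y` by exactly `d` steps of `r`. -/
def RelPow {V : Type u} (r : V → V → Prop) : ℕ → V → V → Prop
  | 0, y, z => z = y
  | d + 1, y, z => ∃ m, r y m ∧ RelPow r d m z

namespace RelPow

variable {V : Type u} {r : V → V → Prop}

lemma one {y z : V} : RelPow r 1 y z ↔ r y z := by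
  simp [RelPow]

lemma add {a b : ℕ} {y z : V} :
    RelPow r (a + b) y z ↔ ∃ m, RelPow r a y m ∧ RelPow r b m z := by
  induction a generalizing y with
  | zero => simp [RelPow]
  | succ a ih =>
    rw [Nat.add_right_comm]
    simp only [RelPow, ih]
    grind

lemma unique (hr : ∀ y z z', r y z → r y z' → z = z') {d : ℕ} {y z z' : V}
    (h : RelPow r d y z) (h' : RelPow r d y z') : z = z' := by
  induction d generalizing y with
  | zero => exact h.trans h'.symm
  | succ d ih =>
    obtain ⟨m, hm, h⟩ := h
    obtain ⟨m', hm', h'⟩ := h'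
    obtain rfl := hr _ _ _ hm hm'
    exact ih h h'

lemma exists_of_reflTransGen {y z : V} (h : Relation.ReflTransGen r y z) :
    ∃ d, RelPow r d y z := by
  induction h using Relation.ReflTransGen.head_induction_on with
  | refl => exact ⟨0, rfl⟩
  | head hab _ ih =>
    obtain ⟨d, hd⟩ := ih
    exact ⟨d + 1, _, hab, hd⟩

/-- In a finite type a reachable element is reached in fewer steps than there are elements. -/
lemma exists_lt_card [Fintype V] {y z : V} (h : Relation.ReflTransGen r y z) :
    ∃ d < Fintype.card V, RelPow r d y z := by
  classical
  have hex := exists_of_reflTransGen h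
  refine ⟨Nat.find hex, ?_, Nat.find_spec hex⟩
  have hsplit (i : Fin (Nat.find hex + 1)) :
      ∃ m, RelPow r i y m ∧ RelPow r (Nat.find hex - i) m z := by
    rw [← add, Nat.add_sub_cancel' (Nat.le_of_lt_succ i.2)]
    exact Nat.find_spec hex
  choose f hf hf' using hsplit
  -- A repeated point on a shortest path could be short-circuited, so its `Nat.find hex + 1` points
  -- are distinct.
  have hle (i j : Fin (Nat.find hex + 1)) (hij : f i = f j) : j ≤ i := by
    by_contra! hlt
    have : RelPow r (i + (Nat.find hex - j)) y z := add.2 ⟨f i, hf i, hij ▸ hf' j⟩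
    have := Nat.find_min' hex this
    have := j.2
    rw [Fin.lt_def] at hlt
    omega
  have hinj : Function.Injective f := fun i j hij => le_antisymm (hle j i hij.symm) (hle i j hij)
  simpa using Fintype.card_le_of_injective f hinj

end RelPow

/-! ### Walks described by their turns, and their definability. -/

namespace RotationSystem

open KVarFormula

variable {V : Type u} {G : SimpleGraph V} (R : RotationSystem G)

lemma eq_of_T {x y z z' : V} (h : R.T x y z) (h' : R.T x y z') : z = z' :=
  (R.existsUnique_next x y (R.adj_of_T _ _ _ h).1).unique h h'

/-- `R.IsWalk w a b c` says that `c` is the last vertex of the walk that starts with the edge from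
`a` to `b` and makes the turns listed in `w`: a turn `d` leaves a vertex along the edge that comes
`d` places after the edge of arrival in the rotation. -/
def IsWalk : List ℕ → V → V → V → Prop
  | [], _, b, c => c = b
  | d :: w, a, b, c => ∃ g, RelPow (R.T b) d a g ∧ IsWalk w b g c

lemma relPow_unique {x y z z' : V} {d : ℕ} (h : RelPow (R.T x) d y z)
    (h' : RelPow (R.T x) d y z') : z = z' :=
  RelPow.unique (r := R.T x) (fun _ _ _ => R.eq_of_T) h h'

variable {R} in
lemma IsWalk.unique {w : List ℕ} {a b c c' : V} (h : R.IsWalk w a b c) (h' : R.IsWalk w a b c') :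
    c = c' := by
  induction w generalizing a b with
  | nil => exact h.trans h'.symm
  | cons d w ih =>
    obtain ⟨g, hg, h⟩ := h
    obtain ⟨g', hg', h'⟩ := h'
    obtain rfl := R.relPow_unique hg hg'
    exact ih h h'

lemma isWalk_singleton {d : ℕ} {a b c : V} : R.IsWalk [d] a b c ↔ RelPow (R.T b) d a c := by
  simp [IsWalk]

/-- A turn is measured from the edge of arrival, so cutting a walk requires remembering the edge
`ef` and not just one vertex. Since turns are deterministic, the walks to `e` and to `f` can be
described separately. -/
lemma isWalk_append_cons {w₁ w₂ : List ℕ} {d : ℕ} {a b c : V} :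
    R.IsWalk (w₁ ++ d :: w₂) a b c ↔
      ∃ e f, R.IsWalk w₁ a b e ∧ R.IsWalk (w₁ ++ [d]) a b f ∧ R.IsWalk w₂ e f c := by
  induction w₁ generalizing a b with
  | nil => simp [IsWalk]
  | cons d' w₁ ih =>
    simp only [List.cons_append, IsWalk, ih]
    constructor
    · rintro ⟨g, hg, e, f, he, hf, h⟩
      exact ⟨e, f, ⟨g, hg, he⟩, ⟨g, hg, hf⟩, h⟩
    · rintro ⟨e, f, ⟨g, hg, he⟩, ⟨g', hg', hf⟩, h⟩
      obtain rfl := R.relPow_unique hg hg'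
      exact ⟨g, hg, e, f, he, hf, h⟩

/-- The previous and the next vertex of a walk are both neighbors of the current one, hence lie on
its single rotation cycle, and some turn leads from one to the other. -/
lemma exists_isWalk [Fintype V] {a b c : V} (hab : G.Adj a b) (p : G.Walk b c) :
    ∃ w : List ℕ, w.length = p.length ∧ (∀ d ∈ w, d < Fintype.card V) ∧ R.IsWalk w a b c := by
  induction p generalizing a with
  | nil => exact ⟨[], rfl, by simp, rfl⟩
  | cons hbg p ih =>
    obtain ⟨w, hl, hw, h⟩ := ih hbg
    obtain ⟨d, hd, hT⟩ := RelPow.exists_lt_card (R.reachable _ _ _ hab.symm hbg)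
    exact ⟨d :: w, by simp [hl], by simpa [hd] using hw, _, hT, h⟩

lemma ternaryDefinable_relPow {k d : ℕ} (hd : d ≤ 2 ^ k) :
    letI := R.toStructure
    TernaryDefinable rotationLanguage k fun x y z => RelPow (R.T x) d y z := by
  let := R.toStructure
  have zero (k : ℕ) :
      TernaryDefinable rotationLanguage k fun x y z => RelPow (R.T x) 0 y z :=
    ternaryDefinable_eq_right
  induction k generalizing d with
  | zero =>
    obtain rfl | rfl : d = 0 ∨ d = 1 := by simp at hd; omega
    · exact zero 0
    · simp only [RelPow.one]
      intro i j l _ _ _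
      refine ⟨rel RotationRel.rot fun m => .var (![i, j, l] m), bounded_rel_var ?_, fun v => ?_⟩
      · intro m; fin_cases m <;> simp
      · rfl
  | succ k ih =>
    rw [pow_succ] at hd
    have := (ih (d := d / 2) (by omega)).comp (ih (d := d - d / 2) (by omega))
    simp only [← RelPow.add] at this
    rwa [Nat.add_sub_cancel' (Nat.div_le_self d 2)] at this

lemma ternaryDefinable_isWalk {k m : ℕ} {w : List ℕ} (hw : ∀ d ∈ w, d ≤ 2 ^ m)
    (hl : w.length ≤ 2 ^ k) :
    letI := R.toStructure
    TernaryDefinable rotationLanguage (2 * k + m) (R.IsWalk w) := by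
  let := R.toStructure
  induction k generalizing w with
  | zero =>
    match w, hl with
    | [], _ => exact ternaryDefinable_eq_right
    | [d], _ =>
      have : R.IsWalk [d] = fun a b c => RelPow (R.T b) d a c := by
        funext a b c; exact propext R.isWalk_singleton
      rw [this]
      simpa using (R.ternaryDefinable_relPow (hw d (by simp))).swap
  | succ k ih =>
    rcases le_total w.length (2 ^ k) with h | h
    · exact (ih hw h).mono (by omega)
    · have hpos := Nat.two_pow_pos k
      have hlt : 2 ^ k - 1 < w.length := by omega
      -- The cut comes after `2 ^ k - 1` turns so that the prefix including the turn `d`, the longer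
      -- of the two that are needed, still has at most `2 ^ k` turns.
      have hsplit : w = w.take (2 ^ k - 1) ++ w[2 ^ k - 1] :: w.drop (2 ^ k - 1 + 1) := by simp
      set w₁ := w.take (2 ^ k - 1) with hw₁
      set w₂ := w.drop (2 ^ k - 1 + 1) with hw₂
      set d := w[2 ^ k - 1]
      have hl₁ : w₁.length = 2 ^ k - 1 := by simp [hw₁]; omega
      have hl₂ : w₂.length ≤ 2 ^ k := by simp [hw₂]; rw [pow_succ] at hl; omega
      clear_value w₁ w₂ d
      subst hsplit
      have := (ih (w := w₁) (fun x hx => hw x (by simp [hx])) (by omega)).comp_pair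
        (ih (w := w₁ ++ [d]) (fun x hx => hw x (by simp at hx ⊢; tauto)) (by simp; omega))
        (ih (w := w₂) (fun x hx => hw x (by simp [hx])) hl₂)
      simp only [← R.isWalk_append_cons] at this
      exact this.mono (by omega)

/-- After two suitable vertices have been fixed, every vertex is definable with small quantifier
depth. -/
lemma exists_ternaryDefinable_eq [Fintype V] (hG : G.Connected) :
    letI := R.toStructure
    ∃ a b : V, ∀ u : V, ∃ Q : V → V → V → Prop,
      TernaryDefinable rotationLanguage (3 * Nat.clog 2 (Fintype.card V)) Q ∧
        ∀ c, Q a b c ↔ c = u := by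
  let := R.toStructure
  classical
  obtain ⟨a⟩ := hG.nonempty
  by_cases hV : ∃ b, G.Adj a b
  · obtain ⟨b, hab⟩ := hV
    refine ⟨a, b, fun u => ?_⟩
    obtain ⟨p⟩ := hG.preconnected b u
    -- Passing to a path keeps the number of turns below the number of vertices.
    obtain ⟨w, hl, hw, h⟩ := R.exists_isWalk hab p.toPath.1
    have hcard := Nat.le_pow_clog one_lt_two (Fintype.card V)
    have := p.toPath.2.length_lt
    refine ⟨R.IsWalk w, ?_, fun c => ⟨fun hc => hc.unique h, fun hc => hc ▸ h⟩⟩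
    refine (R.ternaryDefinable_isWalk (k := Nat.clog 2 (Fintype.card V))
      (m := Nat.clog 2 (Fintype.card V)) (fun d hd => ?_) ?_).mono (by omega)
    · exact (hw d hd).le.trans hcard
    · omega
  -- Without an edge at `a`, connectedness leaves `a` as the only vertex.
  · refine ⟨a, a, fun u => ⟨fun _ b c => c = b, ternaryDefinable_eq_right, fun c => ?_⟩⟩
    have huniq (x : V) : x = a := by
      obtain ⟨p⟩ := hG.preconnected a x
      cases p with
      | nil => rfl
      | cons h _ => exact absurd ⟨_, h⟩ hV
    simp [huniq u]

/-! ### The defining sentence. -/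

/-- The atomic type of `(u, v, t)`, as a formula about the variables `x_2, x_3, x_4`. -/
noncomputable def atomicType (u v t : V) : KVarFormula rotationLanguage 5 :=
  conj (literal (u = v) (equal (.var 2) (.var 3)))
    (conj (literal (u = t) (equal (.var 2) (.var 4)))
      (conj (literal (G.Adj u v) (rel RotationRel.adj fun m => .var (![2, 3] m)))
        (literal (R.T u v t) (rel RotationRel.rot fun m => .var (![2, 3, 4] m)))))

lemma bounded_atomicType {d : ℕ} (u v t : V) :
    (R.atomicType u v t).Bounded d {0, 1, 2, 3, 4} := by
  refine .conj (.literal (bounded_equal_var ?_ ?_)) (.conj (.literal (bounded_equal_var ?_ ?_))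
    (.conj (.literal (bounded_rel_var ?_)) (.literal (bounded_rel_var ?_)))) <;> decide

/-- The sentence which says, for some values of `x_0` and `x_1`, that the formulas `P u 2` define
the vertices of a structure isomorphic to `R`. -/
noncomputable def sentence [Fintype V] (P : V → Fin 5 → KVarFormula rotationLanguage 5) :
    KVarFormula rotationLanguage 5 :=
  ex 0 <| ex 1 <| conj
    (all 2 <| all 3 <| all 4 <|
      conj (bigDisj fun u => P u 2) <| conj (bigDisj fun u => P u 3) <|
        conj (bigDisj fun u => P u 4) <|
          bigConj fun u => bigConj fun v => bigConj fun t =>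
            imp (P u 2) <| imp (P v 3) <| imp (P t 4) <| R.atomicType u v t)
    (bigConj fun u => ex 2 (P u 2))

/-- The five extra levels are the quantifiers over `x_0, …, x_4`; the clause that every vertex is
named needs only one quantifier below `x_0`, `x_1`. -/
lemma bounded_sentence [Fintype V] {P : V → Fin 5 → KVarFormula rotationLanguage 5} {d : ℕ}
    (hP : ∀ u, ∀ i ∈ ({2, 3, 4} : Finset (Fin 5)), (P u i).Bounded d {0, 1, i}) :
    (R.sentence P).Bounded (d + 5) ∅ := by
  have hP' (s : Finset (Fin 5)) (u : V) (i : Fin 5) (hi : i ∈ ({2, 3, 4} : Finset (Fin 5)))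
      (hs : {0, 1, i} ⊆ s) : (P u i).Bounded d s := (hP u i hi).mono le_rfl hs
  refine .ex (.ex (.conj (.all (.all (.all ?_)))
    (bounded_bigConj fun u => ((hP' _ u 2 (by decide) (by decide)).mono (by omega) subset_rfl).ex)))
  refine .conj (bounded_bigDisj fun u => hP' _ u 2 (by decide) (by decide)) <|
    .conj (bounded_bigDisj fun u => hP' _ u 3 (by decide) (by decide)) <|
    .conj (bounded_bigDisj fun u => hP' _ u 4 (by decide) (by decide)) <|
    bounded_bigConj fun u => bounded_bigConj fun v => bounded_bigConj fun t =>
    (hP' _ u 2 (by decide) (by decide)).imp <| (hP' _ v 3 (by decide) (by decide)).imp <|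
    (hP' _ t 4 (by decide) (by decide)).imp <|
    (R.bounded_atomicType u v t).mono le_rfl (by decide)

lemma realize_atomicType {N : Type w} [rotationLanguage.Structure N] {u v t : V} {x : Fin 5 → N} :
    (R.atomicType u v t).Realize x ↔ (x 2 = x 3 ↔ u = v) ∧ (x 2 = x 4 ↔ u = t) ∧
      (FirstOrder.Language.Structure.RelMap (L := rotationLanguage) RotationRel.adj ![x 2, x 3] ↔
        G.Adj u v) ∧
      (FirstOrder.Language.Structure.RelMap (L := rotationLanguage) RotationRel.rot
        ![x 2, x 3, x 4] ↔ R.T u v t) := by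
  have h₂ : (fun m => x (![2, 3] m)) = ![x 2, x 3] := by
    funext m; fin_cases m <;> rfl
  have h₃ : (fun m => x (![2, 3, 4] m)) = ![x 2, x 3, x 4] := by
    funext m; fin_cases m <;> rfl
  simp [atomicType, Realize, h₂, h₃]

/-- A structure in which the sentence is true is isomorphic to `R`. -/
lemma nonempty_equiv_of_realize_sentence [Fintype V]
    {P : V → Fin 5 → KVarFormula rotationLanguage 5}
    (hP : ∀ u, ∀ i ∈ ({2, 3, 4} : Finset (Fin 5)), (P u i).freeVars ⊆ {0, 1, i})
    {N : Type w} [rotationLanguage.Structure N] {x : Fin 5 → N} (h : (R.sentence P).Realize x) :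
    letI := R.toStructure
    Nonempty (rotationLanguage.Equiv V N) := by
  let := R.toStructure
  simp only [sentence, realize_ex, realize_conj, realize_all, realize_bigDisj, realize_bigConj,
    realize_imp, realize_atomicType] at h
  obtain ⟨a, b, h, hsurj⟩ := h
  set x₀ := Function.update (Function.update x 0 a) 1 b
  -- In an arbitrary `N`, the formulas `P u 2`, `P u 3`, `P u 4` need not define the same set, so
  -- the three are kept apart for now.
  let D (i : Fin 5) (u : V) (y : N) : Prop := (P u i).Realize (Function.update x₀ i y)
  have key (i : Fin 5) (hi : i ∈ ({2, 3, 4} : Finset (Fin 5))) (u : V) (y z t : N) :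
      (P u i).Realize (Function.update (Function.update (Function.update x₀ 2 y) 3 z) 4 t) ↔
        D i u (Function.update (Function.update (Function.update x₀ 2 y) 3 z) 4 t i) := by
    refine realize_congr fun j hj => ?_
    have hj := hP u i hi hj
    fin_cases hi <;> fin_cases hj <;> simp
  simp only [key 2 (by decide), key 3 (by decide), key 4 (by decide)] at h
  simp at h
  choose f₂ hf₂ using fun y => (h y y y).1
  choose f₃ hf₃ using fun y => (h y y y).2.1
  choose f₄ hf₄ using fun y => (h y y y).2.2.1
  have h' (y z t : N) {u v w : V} (hu : D 2 u y) (hv : D 3 v z) (hw : D 4 w t) :=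
    (h y z t).2.2.2 u v w hu hv hw
  -- The equality atoms of the atomic type, read on the triple `(y, y, y)`, force the three namings
  -- to agree.
  have hf₂₃ (y : N) : f₃ y = f₂ y := ((h' y y y (hf₂ y) (hf₃ y) (hf₄ y)).1.1 rfl).symm
  have hf₂₄ (y : N) : f₄ y = f₂ y := ((h' y y y (hf₂ y) (hf₃ y) (hf₄ y)).2.1.1 rfl).symm
  simp only [hf₂₃] at hf₃
  simp only [hf₂₄] at hf₄
  have hf (y z t : N) := h' y z t (hf₂ y) (hf₃ z) (hf₄ t)
  -- Injectivity comes from the same equality atoms, and it rules out infinite `N` as well.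
  have hbij : Function.Bijective f₂ := by
    refine ⟨fun y z hyz => (hf y z z).1.2 hyz, fun u => ?_⟩
    obtain ⟨y, hy⟩ := hsurj u
    exact ⟨y, ((h' y y y hy (hf₃ y) (hf₄ y)).1.1 rfl).symm⟩
  let e : rotationLanguage.Equiv N V :=
    { toEquiv := Equiv.ofBijective f₂ hbij
      map_fun' := fun g => Empty.elim g
      map_rel' := by
        intro m r y
        cases r with
        | adj =>
          have hy : y = ![y 0, y 1] := by funext m; fin_cases m <;> rfl
          rw [hy]
          exact (hf (y 0) (y 1) (y 0)).2.2.1.symm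
        | rot =>
          have hy : y = ![y 0, y 1, y 2] := by funext m; fin_cases m <;> rfl
          rw [hy]
          exact (hf (y 0) (y 1) (y 2)).2.2.2.symm }
  exact ⟨e.symm⟩

lemma realize_sentence [Fintype V] {P : V → Fin 5 → KVarFormula rotationLanguage 5} {a b : V}
    (hP : letI := R.toStructure
      ∀ u, ∀ i ∈ ({2, 3, 4} : Finset (Fin 5)), ∀ x : Fin 5 → V, x 0 = a → x 1 = b →
        ((P u i).Realize x ↔ x i = u)) (x : Fin 5 → V) :
    letI := R.toStructure
    (R.sentence P).Realize x := by
  let := R.toStructure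
  simp only [sentence, realize_ex, realize_conj, realize_all, realize_bigDisj, realize_bigConj,
    realize_imp, realize_atomicType]
  refine ⟨a, b, fun y z t => ?_, fun u => ⟨u, ?_⟩⟩
  · set x' := Function.update (Function.update (Function.update (Function.update
      (Function.update x 0 a) 1 b) 2 y) 3 z) 4 t with hx'
    have h (u : V) (i : Fin 5) (hi : i ∈ ({2, 3, 4} : Finset (Fin 5))) :
        (P u i).Realize x' ↔ x' i = u := hP u i hi x' (by simp [hx']) (by simp [hx'])
    clear_value x'
    rw [exists_congr fun u => h u 2 (by decide), exists_congr fun u => h u 3 (by decide),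
      exists_congr fun u => h u 4 (by decide)]
    refine ⟨⟨_, rfl⟩, ⟨_, rfl⟩, ⟨_, rfl⟩, ?_⟩
    intro u v w hu hv hw
    obtain rfl := (h u 2 (by decide)).1 hu
    obtain rfl := (h v 3 (by decide)).1 hv
    obtain rfl := (h w 4 (by decide)).1 hw
    exact ⟨Iff.rfl, Iff.rfl, Iff.rfl, Iff.rfl⟩
  · rw [hP _ 2 (by decide) _ (by simp) (by simp)]
    simp

end RotationSystem

/-! ### The depth bound. -/

theorem theorem7p1 {V : Type u} [Fintype V] (G : SimpleGraph V) (hG : G.Connected)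
    (R : RotationSystem G) :
    ∃ φ : KVarFormula rotationLanguage 5,
      @KVarFormula.Defines.{u, w} rotationLanguage 5 φ V R.toStructure ∧
        (φ.quantifierDepth : ℝ) < 3 * Real.logb 2 (Fintype.card V) + 8 := by
  let := R.toStructure
  obtain ⟨a, b, h⟩ := R.exists_ternaryDefinable_eq hG
  choose Q hQ hQu using h
  have hne (i : Fin 5) (hi : i ∈ ({2, 3, 4} : Finset (Fin 5))) : 0 ≠ i ∧ 1 ≠ i := by
    decide +revert
  have hP (u : V) (i : Fin 5) : ∃ φ : KVarFormula rotationLanguage 5,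
      i ∈ ({2, 3, 4} : Finset (Fin 5)) →
        φ.Bounded (3 * Nat.clog 2 (Fintype.card V)) {0, 1, i} ∧
          ∀ x : Fin 5 → V, φ.Realize x ↔ Q u (x 0) (x 1) (x i) := by
    by_cases hi : i ∈ ({2, 3, 4} : Finset (Fin 5))
    · obtain ⟨φ, hφ⟩ := hQ u 0 1 i (by decide) (hne i hi).1 (hne i hi).2
      exact ⟨φ, fun _ => hφ⟩
    -- A dummy value: the sentence uses `P u i` only for `i = 2, 3, 4`.
    · exact ⟨.falsum, fun hi' => absurd hi' hi⟩
  choose P hP using hP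
  have hb := R.bounded_sentence fun u i hi => (hP u i hi).1
  refine ⟨R.sentence P, ⟨Finset.subset_empty.1 hb.2, fun x => ?_, fun N _ _ hN hT => ?_⟩, ?_⟩
  · refine R.realize_sentence (a := a) (b := b) (fun u i hi y h₀ h₁ => ?_) x
    rw [(hP u i hi).2, h₀, h₁, hQu]
  · exact not_isEmpty_iff.2 (R.nonempty_equiv_of_realize_sentence
      (fun u i hi => (hP u i hi).1.2) (hT fun _ => Classical.arbitrary N)) hN
  · have hV : Nonempty V := hG.nonempty
    have hdepth : ((R.sentence P).quantifierDepth : ℝ) ≤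
        3 * Nat.clog 2 (Fintype.card V) + 5 := by exact_mod_cast hb.1
    have hlog : (0 : ℝ) ≤ Real.logb 2 (Fintype.card V) :=
      Real.logb_nonneg one_lt_two (by exact_mod_cast Fintype.card_pos)
    -- Rounding up loses strictly less than one, which makes the final bound strict: three times
    -- this loss plus `5` stays below `8`.
    have hclog : (Nat.clog 2 (Fintype.card V) : ℝ) < Real.logb 2 (Fintype.card V) + 1 := by
      have := Nat.ceil_lt_add_one hlog
      rwa [show (2 : ℝ) = (2 : ℕ) by norm_num, Real.natCeil_logb_natCast] at this
    linarith
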